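/- \textbf{Setting.} Let $d\ge 1$. For $n\ge1$ let $\mathcal B_n$ be the set of real-valued $\varphi\in\mathcal D(\mathbb R^d)=C_0^\infty(\mathbb R^d)$ with $\varphi(-x)=\varphi(x)$, $\varphi(x)=0$ for $\|x\|\ge 1/n$, $\int\varphi=1$, $\int x^\alpha\varphi=0$ for all multi-indices $1\le|\alpha|\le n$, and $1\le\int|\varphi|<1+\frac1n$. Fix an ultrafilter $\mathcal U$ on $\mathcal D(\mathbb R^d)$ containing every $\mathcal B_n$. For a set $X$ let ${}^*X$ be the set of families $(x_\varphi)_{\varphi\in\mathcal D(\mathbb R^d)}$ in $X$ modulo equality on a set belonging to $\mathcal U$; in particular this defines ${}^*\mathbb R$, ${}^*\mathbb C$, ${}^*\mathcal S(\mathbb R)$ (from real-valued rapidly decreasing functions) and ${}^*\mathcal E(\mathbb R^2)$ (from real-valued $C^\infty$ functions). Evaluation, derivatives, integrals, absolute values, logarithms and roots are taken on representatives. An internal set is a set of the form $\{\langle x_\varphi\rangle : x_\varphi\in F_\varphi \text{ for } \mathcal U\text{-almost all }\varphi\}$ for a family of sets $(F_\varphi)$, and ${}^*S$ is the internal set with $F_\varphi=S$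 for all $\varphi$. Fix a positive infinitesimal $\rho\in{}^*\mathbb R$. A number $z$ in ${}^*\mathbb R$ or ${}^*\mathbb C$ is $\rho$-moderate if $|z|\le\rho^{-n}$ for some $n\in\mathbb N$, $\rho$-null if $|z|<\rho^n$ for all $n\in\mathbb N$, and $\rho$-finite if $|z|<1/\sqrt[n]{\rho}$ for all integers $n\ge1$. For $m\in\mathbb N_0$ put $$S_m=\Big\{f\in\mathcal S(\mathbb R):\ \int f^2\ne0,\ \int f(x)x^n\,dx=\frac{\int f^2(x)x^n\,dx}{\int f^2(x)\,dx},\ 0\le n\le m\Big\},$$ $$\overline S_m=\Big\{\Theta\in{}^*S_m:\ \Theta(0)=0,\ |\ln\rho|^{-1}\!\int|\Theta(x)x^n|\,dx<1,\ |\ln\rho|^{-1}\!\int|\Theta^2(x)x^n|\,dx<1,\ 0\le n\le m\Big\}.$$ \textbf{Theorem.} (1) The sets $\overline S_m$ are internal and $\overline S_0\supseteq\overline S_1\supseteq\cdots$. (2) Let $\Theta\in\bigcap_m\overline S_m$. Then $\int\Theta=1$ and $\Theta(0)=0$. For all $\rho$-moderate $u_0,v\in{}^*\mathbb R$, the number $A=2\rho(v-u_0)/\int\Theta^2$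 is $\rho$-moderate, and there is $u\in{}^*\mathcal E(\mathbb R^2)$ with $$u(x,t)=u_0+\frac A\rho\,\Theta\Big(\frac{x-vt}{\rho}\Big)\qquad(x,t\in{}^*\mathbb R)$$ which is a weak solution of the Hopf equation up to $\rho$-null error: for every test function $\tau\in\mathcal D(\mathbb R)$ and every $t\in{}^*\mathbb R$ (in particular every $t>0$), $\int\big(u_t(x,t)+u(x,t)u_x(x,t)\big)\tau(x)\,dx$ is $\rho$-null. (3) There is a single $\Theta\in\bigcap_m\overline S_m$ (not depending on $u_0$, $v$, $\tau$, $t$ or any exponent $n$) such that for all $\rho$-moderate $u_0,v\in{}^*\mathbb R$ the function $u$ of (2) also satisfies the conservation law up to $\rho$-null error, i.e. $$\frac{d}{dt}\int_a^b u(x,t)\,dx-\frac12\big[u^2(a,t)-u^2(b,t)\big]\ \text{ is } \rho\text{-null},$$ for all $a,b,t\in{}^*\mathbb R$ with $t>0$ such that each $c\in\{a,b\}$ satisfies either $c=vt$ or $(c-vt)/\rho$ is not $\rho$-finite. If $v\in\mathbb R$, then the conservation law holds up to $\rho$-null error for all $a,b,t\in\mathbb R$ with $t>0$, without further condition. -/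

import Mathlib

open Filter MeasureTheory
open scoped ContDiff SchwartzMap Distributions

noncomputable section

namespace NSHopf

/-! ### The index set and the ultrafilter -/

/-- The space `𝓓(ℝ^d)` of complex-valued smooth functions on `ℝ^d` with compact support. -/
abbrev TestFun (d : ℕ) : Type :=
  𝓓((⊤ : TopologicalSpace.Opens (EuclideanSpace ℝ (Fin d))), ℂ)

/-- The space `𝓓(ℝ)` of complex-valued test functions of one real variable. -/
abbrev TestFunLine : Type := 𝓓((⊤ : TopologicalSpace.Opens ℝ), ℂ)

/-- The basic sets `𝓑ₙ ⊆ 𝓓(ℝ^d)`. -/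
def basicSet (d : ℕ) : ℕ → Set (TestFun d)
  | 0 => Set.univ
  | n + 1 => {φ |
      (∀ x, (φ x).im = 0) ∧ (∀ x, φ (-x) = φ x) ∧
      (∀ x, 1 / ((n : ℝ) + 1) ≤ ‖x‖ → φ x = 0) ∧
      (∫ x, φ x = 1) ∧
      (∀ α : Fin d → ℕ, 1 ≤ ∑ j, α j → ∑ j, α j ≤ n + 1 →
        ∫ x : EuclideanSpace ℝ (Fin d), ((∏ j, x j ^ α j : ℝ) : ℂ) * φ x = 0) ∧
      1 ≤ ∫ x, ‖φ x‖ ∧ ∫ x, ‖φ x‖ < 1 + 1 / ((n : ℝ) + 1)}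

/-- The ultrafilter `U` on `𝓓(ℝ^d)` contains the basic filter
`{Φ | 𝓑ₙ ⊆ Φ for some n}`. -/
def ContainsBasicFilter {d : ℕ} (U : Ultrafilter (TestFun d)) : Prop :=
  ∀ Φ : Set (TestFun d), (∃ n, basicSet d n ⊆ Φ) → Φ ∈ U

/-! ### Nonstandard objects over an ultrafilter -/

variable {ι : Type*} (U : Ultrafilter ι)

/-- The nonstandard extension `*X`: families in `X` modulo equality `U`-almost everywhere.
For `X = ℝ`, `ℂ`, `𝓢(ℝ, ℝ)` or a space of smooth functions this gives `*ℝ`, `*ℂ`, `*𝓢(ℝ)`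
and `*𝓔`. -/
abbrev Ext (X : Type*) : Type _ := Germ (U : Filter ι) X

variable {U}

/-- Value `⟨fᵢ(xᵢ)⟩` of an internal function `⟨fᵢ⟩` at a point `⟨xᵢ⟩`. -/
def starApply {X Y : Type*} (F : Ext U (X → Y)) (x : Ext U X) : Ext U Y :=
  Germ.map₂ (fun f y => f y) F x

/-- The `*`-integral `⟨∫ fᵢ⟩` of an internal function over the whole line. -/
def starIntegral {E : Type*} [NormedAddCommGroup E] [NormedSpace ℝ E]
    (F : Ext U (ℝ → E)) : Ext U E :=
  Germ.map (fun f => ∫ x, f x) F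

/-- The internal set `⟨Fᵢ⟩ = {⟨xᵢ⟩ | xᵢ ∈ Fᵢ a.e.}` generated by a family of sets. -/
def internalSet {X : Type*} (F : ι → Set X) : Set (Ext U X) :=
  {z | Germ.LiftRel (fun x S => x ∈ S) z (F : Ext U (Set X))}

/-- A set of nonstandard objects is internal if it is generated by a family of sets. -/
def IsInternal {X : Type*} (S : Set (Ext U X)) : Prop :=
  ∃ F : ι → Set X, S = internalSet F

/-- The nonstandard extension `*S` of a standard set `S`. -/
def starSet {X : Type*} (S : Set X) : Set (Ext U X) :=
  internalSet (fun _ => S)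

/-- Absolute value `⟨|zᵢ|⟩ ∈ *ℝ` of a number in `*ℝ` or `*ℂ`. -/
def starAbs {E : Type*} [NormedAddCommGroup E] (z : Ext U E) : Ext U ℝ :=
  Germ.map (fun w => ‖w‖) z

/-- `ρ` is a positive infinitesimal of `*ℝ`. -/
def IsPosInfinitesimal (ρ : Ext U ℝ) : Prop :=
  0 < ρ ∧ ∀ n : ℕ, ρ < ((1 / ((n : ℝ) + 1) : ℝ) : Ext U ℝ)

/-- `ρ`-moderate numbers: `|z| ≤ ρ⁻ⁿ` for some `n`. -/
def RhoModerate {E : Type*} [NormedAddCommGroup E] (ρ : Ext U ℝ) (z : Ext U E) : Prop :=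
  ∃ n : ℕ, starAbs z ≤ (ρ ^ n)⁻¹

/-- `ρ`-null numbers: `|z| < ρⁿ` for all `n`. -/
def RhoNull {E : Type*} [NormedAddCommGroup E] (ρ : Ext U ℝ) (z : Ext U E) : Prop :=
  ∀ n : ℕ, starAbs z < ρ ^ n

/-- `ρ`-finite numbers: `|z| < ρ^(-1/n)` for all positive integers `n`. -/
def RhoFinite {E : Type*} [NormedAddCommGroup E] (ρ : Ext U ℝ) (z : Ext U E) : Prop :=
  ∀ n : ℕ, 0 < n → starAbs z < (Germ.map (fun r : ℝ => r ^ (1 / (n : ℝ))) ρ)⁻¹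

/-! ### Rapidly decreasing functions and the sets `S_m`, `S̄_m` -/

/-- The value `Θ(x)` of `Θ ∈ *𝓢(ℝ)` at `x ∈ *ℝ`. -/
def schwartzVal (Θ : Ext U 𝓢(ℝ, ℝ)) (x : Ext U ℝ) : Ext U ℝ :=
  starApply (Germ.map (fun f y => f y) Θ) x

/-- The `*`-integral `∫ Θ(x) dx`. -/
def integralOf (Θ : Ext U 𝓢(ℝ, ℝ)) : Ext U ℝ :=
  starIntegral (Germ.map (fun f x => f x) Θ)

/-- The `*`-integral `∫ Θ²(x) dx`. -/
def integralSq (Θ : Ext U 𝓢(ℝ, ℝ)) : Ext U ℝ :=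
  starIntegral (Germ.map (fun f x => f x ^ 2) Θ)

/-- The `*`-integral `∫ |Θ(x) xⁿ| dx`. -/
def absMoment (n : ℕ) (Θ : Ext U 𝓢(ℝ, ℝ)) : Ext U ℝ :=
  starIntegral (Germ.map (fun f x => |f x * x ^ n|) Θ)

/-- The `*`-integral `∫ |Θ²(x) xⁿ| dx`. -/
def absMomentSq (n : ℕ) (Θ : Ext U 𝓢(ℝ, ℝ)) : Ext U ℝ :=
  starIntegral (Germ.map (fun f x => |f x ^ 2 * x ^ n|) Θ)

/-- The set `S_m` of the `f ∈ 𝓢(ℝ)` with `∫ f xⁿ = (∫ f² xⁿ) / (∫ f²)` for `0 ≤ n ≤ m`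
(the quotient being meaningful, that is, `∫ f² ≠ 0`). -/
def momentSet (m : ℕ) : Set 𝓢(ℝ, ℝ) :=
  {f | (∫ x, f x ^ 2 ≠ 0) ∧
    ∀ n ≤ m, ∫ x, f x * x ^ n = (∫ x, f x ^ 2 * x ^ n) / ∫ x, f x ^ 2}

/-- The set `S̄_m` of the `Θ ∈ *S_m` with `Θ(0) = 0`, `|ln ρ|⁻¹ ∫ |Θ xⁿ| < 1` and
`|ln ρ|⁻¹ ∫ |Θ² xⁿ| < 1` for `0 ≤ n ≤ m`. -/
def barMomentSet (ρ : Ext U ℝ) (m : ℕ) : Set (Ext U 𝓢(ℝ, ℝ)) :=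
  {Θ | Θ ∈ starSet (U := U) (momentSet m) ∧ schwartzVal Θ 0 = 0 ∧
    ∀ n ≤ m,
      (starAbs (Germ.map Real.log ρ))⁻¹ * absMoment n Θ < 1 ∧
      (starAbs (Germ.map Real.log ρ))⁻¹ * absMomentSq n Θ < 1}

/-! ### Generalized functions of `(x, t)` and the Hopf equation -/

/-- Real-valued smooth functions of `(x, t) ∈ ℝ²`; their extension `Ext U SmoothPlane` consists
of the real-valued members of `*𝓔(ℝ²)`. -/
def SmoothPlane : Type :=
  {f : ℝ → ℝ → ℝ // ContDiff ℝ ∞ (Function.uncurry f)}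

/-- The value `u(x, t)` of `u ∈ *𝓔(ℝ²)` at `x, t ∈ *ℝ`. -/
def planeVal (u : Ext U SmoothPlane) (x t : Ext U ℝ) : Ext U ℝ :=
  starApply (starApply (Germ.map (fun f => f.1) u) x) t

/-- `f_t + f f_x` at `(x, t)`. -/
def hopfExpr (f : ℝ → ℝ → ℝ) (x t : ℝ) : ℝ :=
  deriv (fun s => f x s) t + f x t * deriv (fun y => f y t) x

/-- The `*`-integral `∫ (u_t + u u_x)(x, t) τ(x) dx ∈ *ℂ` for `t ∈ *ℝ`. -/
def hopfPairing (u : Ext U SmoothPlane) (τ : TestFunLine) (t : Ext U ℝ) : Ext U ℂ :=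
  starIntegral (Germ.map₂ (fun f s x => (hopfExpr f.1 x s : ℂ) * τ x) u t)

/-- `(d/dt) ∫ₐᵇ f(x, t) dx`. -/
def massRate (f : ℝ → ℝ → ℝ) (a b t : ℝ) : ℝ :=
  deriv (fun s => ∫ x in a..b, f x s) t

/-- `(d/dt) ∫ₐᵇ u(x, t) dx ∈ *ℝ` for `u ∈ *𝓔(ℝ²)` and `a, b, t ∈ *ℝ`. -/
def starMassRate (u : Ext U SmoothPlane) (a b t : Ext U ℝ) : Ext U ℝ :=
  starApply (starApply (starApply (Germ.map (fun f => massRate f.1) u) a) b) t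

/-- `u(·, t)` satisfies the Hopf equation weakly up to `ρ`-null error for every `t ∈ *ℝ`. -/
def WeakHopfSolution (ρ : Ext U ℝ) (u : Ext U SmoothPlane) : Prop :=
  ∀ (τ : TestFunLine) (t : Ext U ℝ), RhoNull ρ (hopfPairing u τ t)

/-- `(d/dt) ∫ₐᵇ u dx = ½ [u²(a,t) - u²(b,t)]` up to `ρ`-null error. -/
def ConservesOn (ρ : Ext U ℝ) (u : Ext U SmoothPlane) (a b t : Ext U ℝ) : Prop :=
  RhoNull ρ (starMassRate u a b t - 1 / 2 * (planeVal u a t ^ 2 - planeVal u b t ^ 2))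

/-- The point `a` is on the front `x = v t`, or away from it on the scale `ρ`. -/
def OnOrOffFront (ρ v a t : Ext U ℝ) : Prop :=
  a = v * t ∨ ¬ RhoFinite ρ ((a - v * t) / ρ)

/-- The amplitude `A = 2 ρ (v - u₀) / ∫ Θ²`. -/
def amplitude (ρ : Ext U ℝ) (Θ : Ext U 𝓢(ℝ, ℝ)) (u₀ v : Ext U ℝ) : Ext U ℝ :=
  2 * ρ * (v - u₀) / integralSq Θ

/-- `u(x, t) = u₀ + (A / ρ) Θ((x - v t) / ρ)` for all `x, t ∈ *ℝ`. -/
def IsDeltaWave (ρ : Ext U ℝ) (Θ : Ext U 𝓢(ℝ, ℝ)) (u₀ v A : Ext U ℝ)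
    (u : Ext U SmoothPlane) : Prop :=
  ∀ x t : Ext U ℝ, planeVal u x t = u₀ + A / ρ * schwartzVal Θ ((x - v * t) / ρ)

end NSHopf

end

open Filter MeasureTheory
open scoped ContDiff SchwartzMap Distributions

noncomputable section

namespace NSHopf

/-! ### Germ statements as `U`-almost-everywhere statements about representatives. -/

section Germs

variable {ι : Type*} {U : Ultrafilter ι}

/-! Membership in `momentSet m` says that `h = f - f² / ∫ f²` has vanishing moments of order at most
`m`. The amplitude is chosen so that `u_t + u u_x` is the `x`-derivative of a multiple of `h ((x - v
t) / ρ)`. Integrating by parts against `τ` and expanding `τ'` at `v t`, only the Taylor remainder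
survives (`integral_hopfExpr_mul`, `norm_integral_moment_le`). It carries an arbitrarily high power
of `ρ`. All other factors lose only a fixed power: the moments are at most `|ln ρ| ≤ 1/ρ`, and `1 /
∫ f²` is at most `16/ρ` because unit mass and a bounded first moment prevent small energy
(`one_le_mul_integral_sq`).

For existence, `k` with vanishing moments is turned into a solution of `g² - g = e k`, so that `g`
and `g²` have equal moments; a dilation makes the energy one (`exists_mem_momentSet`). One such
function for each `m` is combined by a diagonal choice as `ρ → 0`
(`exists_eventually_mem_decayFiber`), which also secures decay bounds of every order.

These bounds give the conservation law. Its defect is a moderate factor times a difference of values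
of the profile at the two endpoints. The values vanish on the front, where `Θ(0) = 0`, and are
`ρ`-null off it by rapid decay. -/

theorem isPosInfinitesimal_coe {r : ι → ℝ} :
    IsPosInfinitesimal (U := U) (r : Ext U ℝ) ↔
      (∀ᶠ i in U, 0 < r i) ∧ ∀ n : ℕ, ∀ᶠ i in U, r i < 1 / ((n : ℝ) + 1) := by
  refine and_congr Germ.coe_pos (forall_congr' fun n => ?_)
  exact Germ.coe_lt (g := fun _ => 1 / ((n : ℝ) + 1))

theorem rhoModerate_coe {E : Type*} [NormedAddCommGroup E] {r : ι → ℝ} {z : ι → E} :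
    RhoModerate (U := U) (r : Ext U ℝ) (z : Ext U E) ↔
      ∃ n : ℕ, ∀ᶠ i in U, ‖z i‖ ≤ (r i ^ n)⁻¹ := Iff.rfl

theorem rhoNull_coe {E : Type*} [NormedAddCommGroup E] {r : ι → ℝ} {z : ι → E} :
    RhoNull (U := U) (r : Ext U ℝ) (z : Ext U E) ↔
      ∀ n : ℕ, ∀ᶠ i in U, ‖z i‖ < r i ^ n :=
  forall_congr' fun n => Germ.coe_lt (f := fun i => ‖z i‖) (g := fun i => r i ^ n)

theorem rhoFinite_coe {E : Type*} [NormedAddCommGroup E] {r : ι → ℝ} {z : ι → E} :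
    RhoFinite (U := U) (r : Ext U ℝ) (z : Ext U E) ↔
      ∀ n : ℕ, 0 < n → ∀ᶠ i in U, ‖z i‖ < (r i ^ (1 / (n : ℝ)))⁻¹ :=
  forall₂_congr fun n _ =>
    Germ.coe_lt (f := fun i => ‖z i‖) (g := fun i => (r i ^ (1 / (n : ℝ)))⁻¹)

/-- The fibre over the value `r` of `ρ` of the internal set `barMomentSet ρ m`. -/
def barFiber (r : ℝ) (m : ℕ) : Set 𝓢(ℝ, ℝ) :=
  {f | f ∈ momentSet m ∧ f 0 = 0 ∧ ∀ n ≤ m,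
    |Real.log r|⁻¹ * ∫ x, |f x * x ^ n| < 1 ∧ |Real.log r|⁻¹ * ∫ x, |f x ^ 2 * x ^ n| < 1}

theorem coe_mem_barMomentSet {r : ι → ℝ} {f : ι → 𝓢(ℝ, ℝ)} {m : ℕ} :
    (f : Ext U 𝓢(ℝ, ℝ)) ∈ barMomentSet (U := U) (r : Ext U ℝ) m ↔
      ∀ᶠ i in U, f i ∈ barFiber (r i) m := by
  have h1 (n : ℕ) : (starAbs (Germ.map Real.log (r : Ext U ℝ)))⁻¹ * absMoment n (f : Ext U 𝓢(ℝ, ℝ))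
      < 1 ↔ ∀ᶠ i in U, |Real.log (r i)|⁻¹ * ∫ x, |f i x * x ^ n| < 1 :=
    Germ.coe_lt (f := fun i => |Real.log (r i)|⁻¹ * ∫ x, |f i x * x ^ n|) (g := fun _ => 1)
  have h2 (n : ℕ) :
      (starAbs (Germ.map Real.log (r : Ext U ℝ)))⁻¹ * absMomentSq n (f : Ext U 𝓢(ℝ, ℝ))
      < 1 ↔ ∀ᶠ i in U, |Real.log (r i)|⁻¹ * ∫ x, |f i x ^ 2 * x ^ n| < 1 :=
    Germ.coe_lt (f := fun i => |Real.log (r i)|⁻¹ * ∫ x, |f i x ^ 2 * x ^ n|) (g := fun _ => 1)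
  have h3 : schwartzVal (f : Ext U 𝓢(ℝ, ℝ)) 0 = 0 ↔ ∀ᶠ i in U, f i 0 = 0 :=
    Germ.coe_eq (f := fun i => f i 0) (g := fun _ => 0)
  have h4 : (f : Ext U 𝓢(ℝ, ℝ)) ∈ starSet (U := U) (momentSet m) ↔
      ∀ᶠ i in U, f i ∈ momentSet m := Iff.rfl
  simp only [barMomentSet, barFiber, Set.mem_ofPred_eq, eventually_and, h1, h2, h3, h4]
  refine and_congr_right fun _ => and_congr_right fun _ => ?_
  -- Only finitely many conditions `n ≤ m` occur, so they hold simultaneously almost everywhere.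
  have := (Set.finite_Iic m).eventually_all (l := (U : Filter ι))
    (p := fun n i => |Real.log (r i)|⁻¹ * ∫ x, |f i x * x ^ n| < 1 ∧
      |Real.log (r i)|⁻¹ * ∫ x, |f i x ^ 2 * x ^ n| < 1)
  simp only [Set.mem_Iic, eventually_and] at this
  exact this.symm

theorem isInternal_barMomentSet (ρ : Ext U ℝ) (m : ℕ) : IsInternal (barMomentSet ρ m) := by
  induction ρ using Germ.inductionOn with | _ r
  refine ⟨fun i => barFiber (r i) m, Set.ext fun Θ => ?_⟩
  induction Θ using Germ.inductionOn with | _ f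
  exact coe_mem_barMomentSet

theorem antitone_momentSet : Antitone momentSet := fun _ _ h _ hf =>
  ⟨hf.1, fun n hn => hf.2 n (hn.trans h)⟩

theorem antitone_barFiber (r : ℝ) : Antitone (barFiber r) := fun _ _ h _ hf =>
  ⟨antitone_momentSet h hf.1, hf.2.1, fun n hn => hf.2.2 n (hn.trans h)⟩

theorem antitone_barMomentSet (ρ : Ext U ℝ) : Antitone (barMomentSet ρ) := by
  induction ρ using Germ.inductionOn with | _ r
  intro m n h Θ
  induction Θ using Germ.inductionOn with | _ f
  exact fun hΘ => coe_mem_barMomentSet.2 <|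
    (coe_mem_barMomentSet.1 hΘ).mono fun i hi => antitone_barFiber _ h hi

end Germs

/-! ### The travelling wave and its germ. -/

/-- The travelling wave `u₀ + (A / r) f ((x - v t) / r)` with `A = 2 r (v - u₀) / ∫ f²`. -/
def wave (r : ℝ) (f : 𝓢(ℝ, ℝ)) (u₀ v : ℝ) (x t : ℝ) : ℝ :=
  u₀ + 2 * r * (v - u₀) / (∫ y, f y ^ 2) / r * f ((x - v * t) / r)

theorem contDiff_wave (r : ℝ) (f : 𝓢(ℝ, ℝ)) (u₀ v : ℝ) :
    ContDiff ℝ ∞ (Function.uncurry (wave r f u₀ v)) := by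
  have := f.smooth ⊤
  unfold wave Function.uncurry
  fun_prop

section Germs

variable {ι : Type*} {U : Ultrafilter ι}

/-- The generalized function with representatives `wave (r i) (f i) (u₀ i) (v i)`. -/
def starWave (U : Ultrafilter ι) (r : ι → ℝ) (f : ι → 𝓢(ℝ, ℝ)) (u₀ v : ι → ℝ) :
    Ext U SmoothPlane :=
  Germ.ofFun fun i => ⟨wave (r i) (f i) (u₀ i) (v i), contDiff_wave _ _ _ _⟩

variable {r : ι → ℝ} {f : ι → 𝓢(ℝ, ℝ)} {u₀ v : ι → ℝ}

theorem isDeltaWave_starWave :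
    IsDeltaWave (r : Ext U ℝ) (f : Ext U 𝓢(ℝ, ℝ)) (u₀ : Ext U ℝ) (v : Ext U ℝ)
      (amplitude (r : Ext U ℝ) (f : Ext U 𝓢(ℝ, ℝ)) (u₀ : Ext U ℝ) (v : Ext U ℝ))
      (starWave U r f u₀ v) := by
  intro x t
  induction x using Germ.inductionOn with | _ x
  induction t using Germ.inductionOn with | _ t
  rfl

theorem rhoModerate_amplitude_coe :
    RhoModerate (r : Ext U ℝ)
      (amplitude (r : Ext U ℝ) (f : Ext U 𝓢(ℝ, ℝ)) (u₀ : Ext U ℝ) (v : Ext U ℝ)) ↔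
    ∃ n : ℕ, ∀ᶠ i in U, |2 * r i * (v i - u₀ i) / ∫ y, f i y ^ 2| ≤ (r i ^ n)⁻¹ := Iff.rfl

theorem weakHopfSolution_starWave :
    WeakHopfSolution (r : Ext U ℝ) (starWave U r f u₀ v) ↔
    ∀ (τ : TestFunLine) (t : ι → ℝ) (n : ℕ), ∀ᶠ i in U,
      ‖∫ x, (hopfExpr (wave (r i) (f i) (u₀ i) (v i)) x (t i) : ℂ) * τ x‖ < r i ^ n := by
  refine forall_congr' fun τ => ⟨fun h t => rhoNull_coe.1 (h t), fun h t => ?_⟩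
  induction t using Germ.inductionOn with | _ t
  exact rhoNull_coe.2 (h t)

theorem conservesOn_starWave {a b t : ι → ℝ} :
    ConservesOn (r : Ext U ℝ) (starWave U r f u₀ v) (a : Ext U ℝ) (b : Ext U ℝ) (t : Ext U ℝ) ↔
    ∀ n : ℕ, ∀ᶠ i in U,
      |massRate (wave (r i) (f i) (u₀ i) (v i)) (a i) (b i) (t i) -
        1 / 2 * (wave (r i) (f i) (u₀ i) (v i) (a i) (t i) ^ 2 -
          wave (r i) (f i) (u₀ i) (v i) (b i) (t i) ^ 2)| < r i ^ n :=
  rhoNull_coe (E := ℝ)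

theorem onOrOffFront_coe {a t : ι → ℝ} :
    OnOrOffFront (r : Ext U ℝ) (v : Ext U ℝ) (a : Ext U ℝ) (t : Ext U ℝ) ↔
    (∀ᶠ i in U, a i = v i * t i) ∨ ∃ n : ℕ, 0 < n ∧ ∀ᶠ i in U,
      (r i ^ (1 / (n : ℝ)))⁻¹ ≤ |(a i - v i * t i) / r i| := by
  refine or_congr (Germ.coe_eq (f := a) (g := fun i => v i * t i)) ?_
  refine (not_congr (rhoFinite_coe (z := fun i => (a i - v i * t i) / r i))).trans ?_
  push Not
  refine exists_congr fun n => and_congr_right fun _ => ?_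
  exact Iff.rfl

end Germs

/-! ### Energy bound, Taylor expansion and identities for one wave. -/

section Analysis

theorem integrable_mul_pow (f : 𝓢(ℝ, ℝ)) (n : ℕ) : Integrable fun x => f x * x ^ n := by
  refine (f.integrable_pow_mul volume n).mono ?_ (ae_of_all _ fun x => ?_)
  · have := f.continuous
    exact Continuous.aestronglyMeasurable (by fun_prop)
  · simp [mul_comm]

theorem integrable_sq_mul_pow (f : 𝓢(ℝ, ℝ)) (n : ℕ) : Integrable fun x => f x ^ 2 * x ^ n := by
  have := (integrable_mul_pow f n).bdd_mul f.continuous.aestronglyMeasurable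
    (c := SchwartzMap.seminorm ℝ 0 0 f) (ae_of_all _ fun x => f.norm_le_seminorm ℝ x)
  exact this.congr (ae_of_all _ fun x => by ring)

theorem integrable_sq (f : 𝓢(ℝ, ℝ)) : Integrable fun x => f x ^ 2 := by
  simpa using integrable_sq_mul_pow f 0

theorem integral_eq_one_of_mem_momentSet {f : 𝓢(ℝ, ℝ)} {m : ℕ} (hf : f ∈ momentSet m) :
    ∫ x, f x = 1 := by
  simpa [div_self hf.1] using hf.2 0 (Nat.zero_le m)

/-- A lower bound for the energy of a function of mass one in terms of its first absolute
moment. -/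
theorem one_le_mul_integral_sq {f : 𝓢(ℝ, ℝ)} {L : ℝ} (hL : 0 < L) (h1 : ∫ x, f x = 1)
    (h : ∫ x, |f x * x| ≤ L) : 1 ≤ 16 * L * ∫ x, f x ^ 2 := by
  have i1 : Integrable fun x => |f x * x| := by simpa using (integrable_mul_pow f 1).abs
  have i2 := integrable_sq f
  set S := Set.Icc (-(4 * L)) (4 * L) with hS
  have i3 : Integrable (S.indicator fun _ => (1 : ℝ)) := by
    rw [integrable_indicator_iff measurableSet_Icc]
    exact integrableOn_const (by simp)
  have hS3 : ∫ x, S.indicator (fun _ => (1 : ℝ)) x = 8 * L := by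
    rw [integral_indicator measurableSet_Icc]
    simp [measureReal_def]
    rw [ENNReal.toReal_ofReal (by positivity)]; ring
  -- On `|x| ≤ 4L`, completing the square gives `f ≤ 8L f² + 1/(32L)`; outside, `|f| ≤ |f x| /
  -- (4L)`. The first-moment term and the constant term each contribute at most `1/4`, leaving at
  -- least `1/2` for the energy.
  have key : ∫ x, f x ≤ ∫ x, (1 / (4 * L) * |f x * x| + 8 * L * f x ^ 2 +
      1 / (32 * L) * S.indicator (fun _ => (1 : ℝ)) x) := by
    refine integral_mono f.integrable
      (((i1.const_mul _).add (i2.const_mul _)).add (i3.const_mul _)) fun x => ?_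
    by_cases hx : x ∈ S
    · have e : 8 * L * f x ^ 2 + 1 / (32 * L) * 1 - f x = (16 * L * f x - 1) ^ 2 / (32 * L) := by
        field_simp; ring
      have : 0 ≤ (16 * L * f x - 1) ^ 2 / (32 * L) := by positivity
      have : 0 ≤ 1 / (4 * L) * |f x * x| := by positivity
      simp only [Set.indicator_of_mem hx]
      linarith
    · have hx' : 4 * L ≤ |x| := by
        by_contra hc
        exact hx (abs_le.1 (not_le.1 hc).le)
      simp only [Set.indicator_of_notMem hx, abs_mul]
      have : |f x| ≤ 1 / (4 * L) * (|f x| * |x|) := by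
        rw [one_div, ← div_eq_inv_mul, le_div_iff₀ (by positivity)]
        gcongr
      have : 0 ≤ 8 * L * f x ^ 2 := by positivity
      linarith [le_abs_self (f x)]
  have i4 : Integrable fun x => 1 / (4 * L) * |f x * x| + 8 * L * f x ^ 2 :=
    (i1.const_mul _).add (i2.const_mul _)
  rw [integral_add i4 (i3.const_mul _),
    integral_add (i1.const_mul _) (i2.const_mul _), integral_const_mul, integral_const_mul,
    integral_const_mul, hS3, h1] at key
  have e1 : 1 / (4 * L) * ∫ x, |f x * x| ≤ 1 / (4 * L) * L := by gcongr
  have e2 : 1 / (4 * L) * L = 1 / 4 := by field_simp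
  have e3 : 1 / (32 * L) * (8 * L) = 1 / 4 := by field_simp; norm_num
  linarith

/-- Uniform Taylor expansion of a smooth function with compact support. -/
theorem exists_taylor_bound {E : Type*} [NormedAddCommGroup E] [NormedSpace ℝ E] (n : ℕ) :
    ∀ g : ℝ → E, ContDiff ℝ ∞ g → HasCompactSupport g → ∃ C : ℝ, 0 ≤ C ∧ ∀ x : ℝ,
      ∃ c : ℕ → E, ∀ h : ℝ, ‖g (x + h) - ∑ k ∈ Finset.range n, h ^ k • c k‖ ≤ C * |h| ^ n := by
  induction n with
  | zero =>
    intro g hg hs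
    obtain ⟨C, hC⟩ := hs.exists_bound_of_continuous hg.continuous
    exact ⟨C, (norm_nonneg _).trans (hC 0), fun x => ⟨0, fun h => by simpa using hC (x + h)⟩⟩
  | succ n ih =>
    intro g hg hs
    have hg' : ContDiff ℝ ∞ (deriv g) := (contDiff_infty_iff_deriv.1 hg).2
    obtain ⟨C, hC0, hC⟩ := ih (deriv g) hg' hs.deriv
    refine ⟨C, hC0, fun x => ?_⟩
    obtain ⟨c, hc⟩ := hC x
    -- The expansion of `g'` is integrated termwise. The mean value inequality supplies the extra
    -- factor `|h|` with the same `C`, which therefore stays independent of `x`.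
    refine ⟨fun k => Nat.casesOn k (g x) fun j => ((j : ℝ) + 1)⁻¹ • c j, fun h => ?_⟩
    rw [Finset.sum_range_succ']
    simp only [pow_zero, one_smul]
    set G : ℝ → E := fun y => g (x + y) - ∑ k ∈ Finset.range n, y ^ (k + 1) • ((k : ℝ) + 1)⁻¹ • c k
    have hG (y : ℝ) : HasDerivAt G (deriv g (x + y) - ∑ k ∈ Finset.range n, y ^ k • c k) y := by
      have h1 : HasDerivAt (fun y => g (x + y)) (deriv g (x + y)) y :=
        ((hg.differentiable (by simp)) (x + y)).hasDerivAt.comp_const_add x y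
      refine h1.sub (HasDerivAt.fun_sum fun k _ => ?_)
      have h2 := (hasDerivAt_pow (k + 1) y).smul_const (((k : ℝ) + 1)⁻¹ • c k)
      convert h2 using 1
      have : (k : ℝ) + 1 ≠ 0 := by positivity
      rw [smul_smul]
      congr 1
      push_cast
      field_simp
    have hG0 : G 0 = g x := by simp [G]
    have hb : ∀ y ∈ Set.uIcc 0 h,
        ‖deriv g (x + y) - ∑ k ∈ Finset.range n, y ^ k • c k‖ ≤ C * |h| ^ n := fun y hy => by
      refine (hc y).trans ?_
      have : |y| ≤ |h| := by simpa using Set.abs_sub_left_of_mem_uIcc hy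
      gcongr
    have := (convex_uIcc 0 h).norm_image_sub_le_of_norm_hasDerivWithin_le
      (fun y _ => (hG y).hasDerivWithinAt) hb Set.left_mem_uIcc Set.right_mem_uIcc
    rw [hG0, sub_zero, Real.norm_eq_abs, mul_assoc, ← pow_succ] at this
    rwa [← sub_sub]

section Wave

variable {r : ℝ} {f : 𝓢(ℝ, ℝ)} {u₀ v : ℝ}

theorem wave_eq (hr : r ≠ 0) (x t : ℝ) :
    wave r f u₀ v x t = u₀ + 2 * (v - u₀) / (∫ y, f y ^ 2) * f ((x - v * t) / r) := by
  unfold wave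
  congr 2
  field_simp

theorem hasDerivAt_schwartz (f : 𝓢(ℝ, ℝ)) (x : ℝ) : HasDerivAt f (deriv f x) x :=
  f.differentiableAt.hasDerivAt

theorem hopfExpr_wave (hr : r ≠ 0) (x t : ℝ) :
    hopfExpr (wave r f u₀ v) x t = 2 * (v - u₀) / (∫ y, f y ^ 2) / r *
      deriv f ((x - v * t) / r) * (wave r f u₀ v x t - v) := by
  unfold hopfExpr
  simp only [wave_eq hr]
  set B := 2 * (v - u₀) / (∫ y, f y ^ 2)
  have h1 : HasDerivAt (fun s => u₀ + B * f ((x - v * s) / r))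
      (B * (deriv f ((x - v * t) / r) * (-(v * 1) / r))) t :=
    (((hasDerivAt_schwartz f _).comp t
      ((((hasDerivAt_id t).const_mul v).const_sub x).div_const r)).const_mul B).const_add u₀
  have h2 : HasDerivAt (fun y => u₀ + B * f ((y - v * t) / r))
      (B * (deriv f ((x - v * t) / r) * (1 / r))) x :=
    (((hasDerivAt_schwartz f _).comp x
      (((hasDerivAt_id x).sub_const (v * t)).div_const r)).const_mul B).const_add u₀
  rw [h1.deriv, h2.deriv]
  ring

/-- Integration by parts moves the derivative onto `τ`, and `x = v t + r y` rescales. The amplitude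
makes the linear and quadratic parts of the flux combine into a multiple of `f - f² / ∫ f²`, the
function with vanishing moments. -/
theorem integral_hopfExpr_mul (hr : 0 < r) (hI : ∫ y, f y ^ 2 ≠ 0) {τ : ℝ → ℂ}
    (hτ : ContDiff ℝ ∞ τ) (hs : HasCompactSupport τ) (t : ℝ) :
    ∫ x, (hopfExpr (wave r f u₀ v) x t : ℂ) * τ x =
      (2 * r * (v - u₀) ^ 2 / (∫ y, f y ^ 2) : ℝ) *
        ∫ y, ((f y - f y ^ 2 / ∫ z, f z ^ 2 : ℝ) : ℂ) * deriv τ (v * t + r * y) := by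
  simp only [hopfExpr_wave hr.ne', wave_eq hr.ne']
  set I := ∫ y, f y ^ 2
  set B := 2 * (v - u₀) / I with hB
  -- A primitive of the Hopf expression in the moving frame; the value of `B` makes it `-(2 (v -
  -- u₀)² / I) (f - f² / I)`.
  set F : ℝ → ℝ := fun y => (u₀ - v) * B * f y + B ^ 2 / 2 * f y ^ 2 with hF
  have hfc := f.continuous
  have hFc : Continuous F := by fun_prop
  have hFd (x : ℝ) : HasDerivAt (fun x => ((F ((x - v * t) / r) : ℝ) : ℂ))
      ((B / r * deriv f ((x - v * t) / r) *
        (u₀ + B * f ((x - v * t) / r) - v) : ℝ) : ℂ) x := by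
    have h1 := (hasDerivAt_schwartz f ((x - v * t) / r)).comp x
      (((hasDerivAt_id x).sub_const (v * t)).div_const r)
    have h2 := (h1.const_mul ((u₀ - v) * B)).add ((h1.pow 2).const_mul (B ^ 2 / 2))
    refine HasDerivAt.ofReal_comp (h2.congr_deriv ?_)
    simp only [Function.comp, id]
    push_cast
    ring
  have hd : Continuous (deriv f) := (f.smooth 1).continuous_deriv le_rfl
  have hτc := hτ.continuous
  have hτd : Continuous (deriv τ) := hτ.continuous_deriv (by simp)
  have hFt : Continuous fun x => ((F ((x - v * t) / r) : ℝ) : ℂ) :=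
    Complex.continuous_ofReal.comp (by fun_prop)
  have ibp := integral_mul_deriv_eq_deriv_mul_of_integrable
    (u := fun x => ((F ((x - v * t) / r) : ℝ) : ℂ)) (v := τ) (v' := deriv τ)
    (u' := fun x => ((B / r * deriv f ((x - v * t) / r) *
        (u₀ + B * f ((x - v * t) / r) - v) : ℝ) : ℂ))
    (fun x _ => hFd x) (fun x _ => (hτ.differentiable (by simp) x).hasDerivAt)
    ((hFt.mul hτd).integrable_of_hasCompactSupport hs.deriv.mul_left)
    (Continuous.integrable_of_hasCompactSupport
      ((Complex.continuous_ofReal.comp (by fun_prop)).mul hτc) hs.mul_left)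
    ((hFt.mul hτc).integrable_of_hasCompactSupport hs.mul_left)
  have e1 : ∫ x, ((F ((x - v * t) / r) : ℝ) : ℂ) * deriv τ x =
      r * ∫ y, ((F y : ℝ) : ℂ) * deriv τ (v * t + r * y) := by
    have h := Measure.integral_comp_mul_left
      (fun x => ((F (x / r) : ℝ) : ℂ) * deriv τ (v * t + x)) r
    have h' := integral_add_right_eq_self (μ := volume)
      (fun x => ((F ((x - v * t) / r) : ℝ) : ℂ) * deriv τ x) (v * t)
    simp only [add_comm _ (v * t)] at h'
    simp only [mul_div_cancel_left₀ _ hr.ne'] at h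
    rw [h, ← h', abs_of_pos (inv_pos.2 hr), Complex.real_smul, ← mul_assoc]
    simp [hr.ne']
  rw [← neg_eq_iff_eq_neg] at ibp
  rw [← ibp, e1, ← mul_neg, ← integral_neg, ← integral_const_mul, ← integral_const_mul]
  congr 1
  funext y
  rw [← neg_mul, ← mul_assoc, ← mul_assoc]
  congr 1
  simp only [hF, hB]
  rw [← Complex.ofReal_neg, ← Complex.ofReal_mul, ← Complex.ofReal_mul]
  congr 1
  field_simp
  ring

/-- The moments of `f - f² / ∫ f²` of order below `n` vanish, so the Taylor polynomial of `g` can be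
subtracted for free; the remainder is integrated in absolute value. -/
theorem norm_integral_moment_le {g : ℝ → ℂ} (hg : Continuous g) {n : ℕ} {M C x r : ℝ}
    {c : ℕ → ℂ}     (hr : 0 < r) (hb : ∀ y, ‖g y‖ ≤ M)
    (hc : ∀ h : ℝ, ‖g (x + h) - ∑ k ∈ Finset.range n, h ^ k • c k‖ ≤ C * |h| ^ n)
    (hf : f ∈ momentSet n) :
    ‖∫ y, ((f y - f y ^ 2 / ∫ z, f z ^ 2 : ℝ) : ℂ) * g (x + r * y)‖ ≤
      C * r ^ n * ((∫ y, |f y * y ^ n|) + (∫ y, |f y ^ 2 * y ^ n|) / ∫ z, f z ^ 2) := by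
  set I := ∫ z, f z ^ 2
  have hI : 0 ≤ I := integral_nonneg fun z => sq_nonneg _
  set h : ℝ → ℝ := fun y => f y - f y ^ 2 / I
  have hint (k : ℕ) : Integrable fun y => h y * y ^ k :=
    ((integrable_mul_pow f k).sub ((integrable_sq_mul_pow f k).div_const I)).congr
      (ae_of_all _ fun y => by simp only [h, Pi.sub_apply]; ring)
  have hmom (k : ℕ) (hk : k < n) : ∫ y, h y * y ^ k = 0 := by
    have : ∀ y, h y * y ^ k = f y * y ^ k - f y ^ 2 * y ^ k / I := fun y => by
      simp only [h]; ring
    simp_rw [this]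
    rw [integral_sub (integrable_mul_pow f k) ((integrable_sq_mul_pow f k).div_const I),
      integral_div, hf.2 k hk.le, sub_self]
  have hintP : ∀ k ∈ Finset.range n,
      Integrable fun y => ((h y * y ^ k : ℝ) : ℂ) * (((r ^ k : ℝ) : ℂ) * c k) :=
    fun k _ => (hint k).ofReal.mul_const _
  have hP : ∀ y, (h y : ℂ) * ∑ k ∈ Finset.range n, (r * y) ^ k • c k =
      ∑ k ∈ Finset.range n, ((h y * y ^ k : ℝ) : ℂ) * (((r ^ k : ℝ) : ℂ) * c k) := fun y => by
    rw [Finset.mul_sum]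
    refine Finset.sum_congr rfl fun k _ => ?_
    rw [Complex.real_smul]
    push_cast
    ring
  have hintg : Integrable fun y => (h y : ℂ) * g (x + r * y) := by
    have h0 : Integrable h := by simpa using hint 0
    exact h0.ofReal.mul_bdd (c := M) (Continuous.aestronglyMeasurable (by fun_prop))
      (ae_of_all _ fun y => hb _)
  have e : ∫ y, (h y : ℂ) * g (x + r * y) =
      ∫ y, (h y : ℂ) * (g (x + r * y) - ∑ k ∈ Finset.range n, (r * y) ^ k • c k) := by
    simp_rw [mul_sub, hP]
    rw [integral_sub hintg (integrable_finsetSum _ hintP), integral_finsetSum _ hintP]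
    rw [Finset.sum_eq_zero, sub_zero]
    intro k hk
    rw [integral_mul_const, integral_complex_ofReal, hmom k (Finset.mem_range.1 hk)]
    simp
  have ia := (integrable_mul_pow f n).abs
  have ib := (integrable_sq_mul_pow f n).abs.div_const I
  rw [e, ← integral_div, ← integral_add ia ib, ← integral_const_mul]
  refine norm_integral_le_of_norm_le ((ia.add ib).const_mul _) (ae_of_all _ fun y => ?_)
  rw [norm_mul, Complex.norm_real]
  have h1 : ‖h y‖ ≤ |f y| + f y ^ 2 / I := by
    refine (norm_sub_le _ _).trans_eq ?_
    rw [Real.norm_eq_abs, Real.norm_eq_abs, abs_of_nonneg (by positivity : 0 ≤ f y ^ 2 / I)]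
  calc ‖h y‖ * ‖g (x + r * y) - ∑ k ∈ Finset.range n, (r * y) ^ k • c k‖
      ≤ (|f y| + f y ^ 2 / I) * (C * |r * y| ^ n) :=
        mul_le_mul h1 (hc _) (norm_nonneg _) (by positivity)
    _ = _ := by
        simp only [abs_mul, abs_pow, abs_of_pos hr, sq_abs]
        ring

/-- A primitive of the profile makes the mass explicit; since the wave depends on `x - v t`, its
`t`-derivative is `-v` times its `x`-derivative. -/
theorem massRate_wave (hr : r ≠ 0) (a b t : ℝ) :
    massRate (wave r f u₀ v) a b t =
      v * (wave r f u₀ v a t - wave r f u₀ v b t) := by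
  unfold massRate
  simp only [wave_eq hr]
  set B := 2 * (v - u₀) / (∫ y, f y ^ 2)
  have hfc := f.continuous
  set Φ : ℝ → ℝ := fun z => ∫ y in (0 : ℝ)..z, f y
  have hΦ (z : ℝ) : HasDerivAt Φ (f z) z :=
    intervalIntegral.integral_hasDerivAt_right (hfc.intervalIntegrable _ _)
      (hfc.stronglyMeasurableAtFilter _ _) hfc.continuousAt
  have hint (s : ℝ) : ∫ x in a..b, (u₀ + B * f ((x - v * s) / r)) =
      (u₀ * b + B * (r * Φ ((b - v * s) / r))) - (u₀ * a + B * (r * Φ ((a - v * s) / r))) := by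
    refine intervalIntegral.integral_eq_sub_of_hasDerivAt
      (f := fun x => u₀ * x + B * (r * Φ ((x - v * s) / r))) (fun x _ => ?_)
      (Continuous.intervalIntegrable (by fun_prop) _ _)
    have h1 := (((hΦ ((x - v * s) / r)).comp x
      (((hasDerivAt_id x).sub_const (v * s)).div_const r)).const_mul r).const_mul B
    refine (((hasDerivAt_id x).const_mul u₀).add h1).congr_deriv ?_
    field_simp
  have hd (x : ℝ) : HasDerivAt (fun s => u₀ * x + B * (r * Φ ((x - v * s) / r)))
      (-(v * (B * f ((x - v * t) / r)))) t := by
    have h1 := ((((hΦ ((x - v * t) / r)).comp t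
      ((((hasDerivAt_id t).const_mul v).const_sub x).div_const r)).const_mul r).const_mul
        B).const_add (u₀ * x)
    refine h1.congr_deriv ?_
    field_simp
  simp_rw [hint]
  refine ((hd b).fun_sub (hd a)).deriv.trans ?_
  ring

end Wave

end Analysis

/-! ### Construction of profiles with all required moments and decay. -/

section Existence

/-- Nonzero smooth compactly supported functions vanishing near `0` with vanishing moments. -/
theorem exists_vanishing_moments (m : ℕ) : ∃ k : ℝ → ℝ, ContDiff ℝ ∞ k ∧ HasCompactSupport k ∧
    0 ∉ tsupport k ∧ k ≠ 0 ∧ ∀ n < m, ∫ x, k x * x ^ n = 0 := by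
  induction m with
  | zero =>
    let b : ContDiffBump (2 : ℝ) := ⟨1 / 2, 1, by norm_num, by norm_num⟩
    refine ⟨b, b.contDiff, b.hasCompactSupport, ?_, fun h => ?_, fun n hn => by simp at hn⟩
    · rw [b.tsupport_eq]
      simp [b]
    · have := b.one_of_mem_closedBall (Metric.mem_closedBall_self b.rIn_pos.le)
      rw [h] at this
      simp at this
  | succ m ih =>
    obtain ⟨k, hk, hs, h0, hne, hm⟩ := ih
    have hd (x : ℝ) : HasDerivAt k (deriv k x) x := (hk.differentiable (by simp) x).hasDerivAt
    have hkc := hk.continuous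
    have hdc : Continuous (deriv k) := hk.continuous_deriv (by simp)
    -- Differentiation gains one vanishing moment, by parts. It keeps the function nonzero: a
    -- constant `k` would equal `k 0 = 0`.
    refine ⟨deriv k, (contDiff_infty_iff_deriv.1 hk).2, hs.deriv,
      fun h => h0 (tsupport_deriv_subset h), fun h => hne ?_, fun n hn => ?_⟩
    · funext x
      have := is_const_of_deriv_eq_zero (hk.differentiable (by simp)) (fun x => congrFun h x) x 0
      rw [this, image_eq_zero_of_notMem_tsupport h0]
      rfl
    · have ibp := integral_mul_deriv_eq_deriv_mul_of_integrable
        (u := fun x : ℝ => x ^ n) (u' := fun x => n * x ^ (n - 1)) (v := k) (v' := deriv k)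
        (fun x _ => hasDerivAt_pow n x) (fun x _ => hd x)
        (Continuous.integrable_of_hasCompactSupport (by fun_prop) hs.deriv.mul_left)
        (Continuous.integrable_of_hasCompactSupport
          (Continuous.mul (by fun_prop) hkc) hs.mul_left)
        (Continuous.integrable_of_hasCompactSupport (by fun_prop) hs.mul_left)
      simp only [mul_comm (_ ^ n)] at ibp
      rw [ibp, neg_eq_zero]
      rcases n with _ | n
      · simp
      · simp only [mul_assoc, mul_comm (_ ^ _), integral_const_mul, Nat.add_sub_cancel]
        rw [hm n (by omega), mul_zero]

/-- The sets `S_m` contain functions vanishing at the origin. -/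
theorem exists_mem_momentSet (m : ℕ) : ∃ f ∈ momentSet m, f 0 = 0 := by
  obtain ⟨k, hk, hs, h0, hne, hm⟩ := exists_vanishing_moments (m + 1)
  obtain ⟨M, hM⟩ := hs.exists_bound_of_continuous hk.continuous
  have hM0 : 0 ≤ M := (norm_nonneg _).trans (hM 0)
  -- This gives `|e k| ≤ 1/8`, so `1 + 4 e k` stays positive and its square root is smooth.
  set e : ℝ := 1 / (8 * (M + 1)) with he
  have he0 : 0 < e := by positivity
  have hpos (x : ℝ) : 0 < 1 + 4 * e * k x := by
    have h1 : |e * k x| ≤ 1 / 8 := by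
      rw [abs_mul, abs_of_pos he0, he, div_mul_eq_mul_div, one_mul,
        div_le_div_iff₀ (by positivity) (by norm_num)]
      have := hM x
      rw [Real.norm_eq_abs] at this
      linarith
    have := (abs_le.1 h1).1
    linarith
  -- The root of `g² - g = e k` that vanishes where `k` does; this preserves compact support and the
  -- zero at the origin.
  set g : ℝ → ℝ := fun x => (1 - √(1 + 4 * e * k x)) / 2 with hg
  have hgk (x : ℝ) : g x ^ 2 - g x = e * k x := by
    have := Real.sq_sqrt (hpos x).le
    simp only [hg]
    linear_combination this / 4
  have hgd : ContDiff ℝ ∞ g := by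
    have : ContDiff ℝ ∞ fun x => √(1 + 4 * e * k x) :=
      ContDiff.sqrt (by fun_prop) fun x => (hpos x).ne'
    fun_prop
  have hgs : HasCompactSupport g := hs.comp_left (g := fun y => (1 - √(1 + 4 * e * y)) / 2) (by simp)
  have hg0 : g 0 = 0 := by simp [hg, image_eq_zero_of_notMem_tsupport h0]
  have hgc := hgd.continuous
  have hgi (n : ℕ) : Integrable fun x => g x * x ^ n :=
    Continuous.integrable_of_hasCompactSupport (by fun_prop) hgs.mul_right
  have hgi2 (n : ℕ) : Integrable fun x => g x ^ 2 * x ^ n := by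
    simp only [pow_two, mul_assoc]
    exact Continuous.integrable_of_hasCompactSupport (by fun_prop) hgs.mul_right
  have hmom (n : ℕ) (hn : n ≤ m) : ∫ x, g x ^ 2 * x ^ n = ∫ x, g x * x ^ n := by
    rw [← sub_eq_zero, ← integral_sub (hgi2 n) (hgi n)]
    simp_rw [← sub_mul, hgk, mul_assoc, integral_const_mul]
    rw [hm n (by omega), mul_zero]
  have hsq : 0 < ∫ x, g x ^ 2 := by
    obtain ⟨x, hx⟩ : ∃ x, k x ≠ 0 := by
      by_contra! h
      exact hne (funext h)
    have hgx : g x ≠ 0 := fun h => by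
      have := hgk x
      rw [h] at this
      simp [he0.ne', hx] at this
    have hgs2 : HasCompactSupport fun x => g x ^ 2 := hgs.comp_left (g := fun y => y ^ 2) (by simp)
    exact Continuous.integral_pos_of_hasCompactSupport_nonneg_nonzero (x := x) (by fun_prop) hgs2
      (fun x => sq_nonneg _) (pow_ne_zero 2 hgx)
  set a := ∫ x, g x with ha
  have hga : ∫ x, g x ^ 2 = a := by simpa using hmom 0 (Nat.zero_le m)
  have ha0 : 0 < a := hga ▸ hsq
  -- Dilation by `a = ∫ g = ∫ g²` multiplies the `n`-th moments of `g` and `g²` by the same factor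
  -- and makes the energy one.
  have hscale (p n : ℕ) : ∫ x, g (a * x) ^ p * x ^ n = (a ^ n)⁻¹ * (a⁻¹ * ∫ x, g x ^ p * x ^ n) := by
    have h := Measure.integral_comp_mul_left (fun x => g x ^ p * x ^ n) a
    rw [abs_of_pos (inv_pos.2 ha0), smul_eq_mul] at h
    rw [← h, ← integral_const_mul]
    congr 1
    funext x
    field_simp
    ring
  have hsupp : HasCompactSupport fun x => g (a * x) := by
    simpa using hgs.comp_smul ha0.ne'
  refine ⟨hsupp.toSchwartzMap (hgd.comp (by fun_prop)), ?_, by simpa using hg0⟩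
  have e2 : ∫ x, g (a * x) ^ 2 = 1 := by
    have := hscale 2 0
    simp only [pow_zero, mul_one, inv_one, one_mul, hga] at this
    rw [this, inv_mul_cancel₀ ha0.ne']
  refine ⟨?_, fun n hn => ?_⟩
  · change ∫ x, g (a * x) ^ 2 ≠ 0
    rw [e2]
    exact one_ne_zero
  · change ∫ x, g (a * x) * x ^ n = (∫ x, g (a * x) ^ 2 * x ^ n) / ∫ x, g (a * x) ^ 2
    have h1 := hscale 1 n
    simp only [pow_one] at h1
    rw [e2, div_one, h1, hscale 2 n, hmom n hn]

/-- The members of `barFiber r m` that decay rapidly with constants at most `|ln r|`. -/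
def decayFiber (r : ℝ) (m : ℕ) : Set 𝓢(ℝ, ℝ) :=
  {f | f ∈ barFiber r m ∧ ∀ n ≤ m, ∀ y, |f y * y ^ n| ≤ |Real.log r|}

theorem antitone_decayFiber (r : ℝ) : Antitone (decayFiber r) := fun _ _ h _ hf =>
  ⟨antitone_barFiber r h hf.1, fun n hn => hf.2 n (hn.trans h)⟩

theorem exists_mem_decayFiber (m : ℕ) :
    ∃ (f : 𝓢(ℝ, ℝ)) (C : ℝ), ∀ r : ℝ, C < |Real.log r| → f ∈ decayFiber r m := by
  obtain ⟨f, hf, hf0⟩ := exists_mem_momentSet m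
  have hle (b : ℕ → ℝ) (hb : ∀ n, 0 ≤ b n) (n : ℕ) (hn : n ≤ m) :
      b n ≤ ∑ j ∈ Finset.range (m + 1), b j :=
    Finset.single_le_sum (fun j _ => hb j) (Finset.mem_range.2 (by omega))
  set b : ℕ → ℝ := fun n => (∫ x, |f x * x ^ n|) + (∫ x, |f x ^ 2 * x ^ n|) +
    SchwartzMap.seminorm ℝ n 0 f
  have h1 (n : ℕ) : 0 ≤ ∫ x, |f x * x ^ n| := integral_nonneg fun x => abs_nonneg _
  have h2 (n : ℕ) : 0 ≤ ∫ x, |f x ^ 2 * x ^ n| := integral_nonneg fun x => abs_nonneg _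
  have h3 (n : ℕ) : 0 ≤ SchwartzMap.seminorm ℝ n 0 f := apply_nonneg _ _
  have hb (n : ℕ) : 0 ≤ b n := add_nonneg (add_nonneg (h1 n) (h2 n)) (h3 n)
  refine ⟨f, ∑ j ∈ Finset.range (m + 1), b j, fun r hr => ?_⟩
  have hpos : 0 < |Real.log r| := (Finset.sum_nonneg fun j _ => hb j).trans_lt hr
  have hlt (n : ℕ) (hn : n ≤ m) : (∫ x, |f x * x ^ n|) + (∫ x, |f x ^ 2 * x ^ n|) +
    SchwartzMap.seminorm ℝ n 0 f < |Real.log r| := (hle b hb n hn).trans_lt hr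
  refine ⟨⟨hf, hf0, fun n hn => ?_⟩, fun n hn y => ?_⟩
  · have := hlt n hn
    rw [inv_mul_lt_iff₀ hpos, inv_mul_lt_iff₀ hpos]
    constructor <;> linarith [h1 n, h2 n, h3 n]
  · have e := SchwartzMap.norm_pow_mul_le_seminorm ℝ f n y
    have : |f y * y ^ n| ≤ SchwartzMap.seminorm ℝ n 0 f := by
      simpa [abs_mul, mul_comm] using e
    linarith [hlt n hn, h1 n, h2 n]

theorem tendsto_abs_log {ι : Type*} {l : Filter ι} {r : ι → ℝ}
    (hr : Tendsto r l (nhdsWithin 0 (Set.Ioi 0))) :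
    Tendsto (fun i => |Real.log (r i)|) l atTop :=
  tendsto_abs_atBot_atTop.comp (Real.tendsto_log_nhdsGT_zero.comp hr)

/-- Saturation by hand: since `|ln r| → ∞`, each threshold `C m` is eventually passed and the fibres
decrease in `m`, so the profile with the largest admissible index works for every `m`. -/
theorem exists_eventually_mem_decayFiber {ι : Type*} {l : Filter ι} {r : ι → ℝ}
    (hr : Tendsto r l (nhdsWithin 0 (Set.Ioi 0))) :
    ∃ f : ι → 𝓢(ℝ, ℝ), ∀ m, ∀ᶠ i in l, f i ∈ decayFiber (r i) m := by
  classical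
  choose F C hF using exists_mem_decayFiber
  -- The cap `⌊|ln r|⌋₊` keeps the search finite and still tends to infinity.
  refine ⟨fun i => F (Nat.findGreatest (fun m => C m < |Real.log (r i)|) ⌊|Real.log (r i)|⌋₊),
    fun m => ?_⟩
  filter_upwards [(tendsto_abs_log hr).eventually_gt_atTop (C m),
    (tendsto_abs_log hr).eventually_ge_atTop (m : ℝ)] with i h1 h2
  have hm : m ≤ ⌊|Real.log (r i)|⌋₊ := Nat.le_floor h2
  exact antitone_decayFiber _ (Nat.le_findGreatest hm h1)
    (hF _ _ (Nat.findGreatest_spec (P := fun m => C m < |Real.log (r i)|) hm h1))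

end Existence

/-! ### Estimates as `r → 0⁺`. -/

section Asymptotics

theorem abs_log_le_inv {r : ℝ} (h0 : 0 < r) (h1 : r < 1) : |Real.log r| ≤ r⁻¹ := by
  have := Real.abs_log_mul_self_lt r h0 h1.le
  rw [abs_mul, abs_of_pos h0] at this
  rw [← one_div, le_div_iff₀ h0]
  exact this.le

theorem abs_log_pos {r : ℝ} (h0 : 0 < r) (h1 : r < 1) : 0 < |Real.log r| :=
  abs_pos.2 (Real.log_neg h0 h1).ne

theorem moments_le_of_mem_barFiber {r : ℝ} {f : 𝓢(ℝ, ℝ)} {m n : ℕ} (h0 : 0 < r) (h1 : r < 1)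
    (hf : f ∈ barFiber r m) (hn : n ≤ m) :
    ∫ x, |f x * x ^ n| ≤ |Real.log r| ∧ ∫ x, |f x ^ 2 * x ^ n| ≤ |Real.log r| := by
  have h := hf.2.2 n hn
  have hl := abs_log_pos h0 h1
  rw [inv_mul_lt_iff₀ hl, inv_mul_lt_iff₀ hl, mul_one] at h
  exact ⟨h.1.le, h.2.le⟩

theorem inv_integral_sq_le {r : ℝ} {f : 𝓢(ℝ, ℝ)} (h0 : 0 < r) (h1 : r < 1)
    (hf : f ∈ barFiber r 1) : 0 < ∫ x, f x ^ 2 ∧ (∫ x, f x ^ 2)⁻¹ ≤ 16 * r⁻¹ := by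
  have hI : 0 < ∫ x, f x ^ 2 :=
    (integral_nonneg fun x => sq_nonneg (f x)).lt_of_ne' hf.1.1
  refine ⟨hI, ?_⟩
  have hb := one_le_mul_integral_sq (abs_log_pos h0 h1) (integral_eq_one_of_mem_momentSet hf.1)
    (by simpa using (moments_le_of_mem_barFiber h0 h1 hf le_rfl).1)
  rw [inv_le_iff_one_le_mul₀ hI]
  refine hb.trans ?_
  have := abs_log_le_inv h0 h1
  gcongr

variable {ι : Type*} {l : Filter ι} {r : ι → ℝ} {f : ι → 𝓢(ℝ, ℝ)} {u₀ v : ι → ℝ}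

theorem eventually_mul_lt_one (hr : Tendsto r l (nhdsWithin 0 (Set.Ioi 0))) (C : ℝ) :
    ∀ᶠ i in l, 0 < r i ∧ r i < 1 ∧ C * r i < 1 := by
  have h := tendsto_nhdsWithin_iff.1 hr
  have h2 : Tendsto (fun i => C * r i) l (nhds 0) := by simpa using h.1.const_mul C
  filter_upwards [h.2, h.1.eventually_lt_const zero_lt_one, h2.eventually_lt_const zero_lt_one]
    with i a b c using ⟨a, b, c⟩

theorem exists_abs_sub_le (hr : Tendsto r l (nhdsWithin 0 (Set.Ioi 0)))
    (hu : ∃ n : ℕ, ∀ᶠ i in l, ‖u₀ i‖ ≤ (r i ^ n)⁻¹) (hv : ∃ n : ℕ, ∀ᶠ i in l, ‖v i‖ ≤ (r i ^ n)⁻¹) :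
    ∃ n : ℕ, ∀ᶠ i in l, |v i - u₀ i| ≤ (r i ^ n)⁻¹ := by
  obtain ⟨a, ha⟩ := hu
  obtain ⟨b, hb⟩ := hv
  refine ⟨a + b + 1, ?_⟩
  filter_upwards [ha, hb, eventually_mul_lt_one hr 2] with i h1 h2 ⟨h3, h4, h5⟩
  have h6 : (r i ^ a)⁻¹ ≤ (r i ^ (a + b))⁻¹ :=
    inv_anti₀ (by positivity) (pow_le_pow_of_le_one h3.le h4.le (by omega))
  have h7 : (r i ^ b)⁻¹ ≤ (r i ^ (a + b))⁻¹ :=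
    inv_anti₀ (by positivity) (pow_le_pow_of_le_one h3.le h4.le (by omega))
  have h8 : 2 ≤ (r i)⁻¹ := by
    rw [le_inv_comm₀ two_pos h3]; linarith
  calc |v i - u₀ i| ≤ |v i| + |u₀ i| := abs_sub _ _
    _ ≤ 2 * (r i ^ (a + b))⁻¹ := by
        rw [Real.norm_eq_abs] at h1 h2
        linarith
    _ ≤ (r i)⁻¹ * (r i ^ (a + b))⁻¹ := by gcongr
    _ = _ := by rw [pow_succ, mul_inv]; ring

theorem exists_amplitude_le (hr : Tendsto r l (nhdsWithin 0 (Set.Ioi 0)))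
    (hf : ∀ m, ∀ᶠ i in l, f i ∈ barFiber (r i) m)
    (hd : ∃ n : ℕ, ∀ᶠ i in l, |v i - u₀ i| ≤ (r i ^ n)⁻¹) :
    ∃ n : ℕ, ∀ᶠ i in l, |2 * r i * (v i - u₀ i) / ∫ y, f i y ^ 2| ≤ (r i ^ n)⁻¹ := by
  obtain ⟨N, hN⟩ := hd
  refine ⟨N + 1, ?_⟩
  filter_upwards [hN, hf 1, eventually_mul_lt_one hr 32] with i h1 h2 ⟨h3, h4, h5⟩
  obtain ⟨hI, hI'⟩ := inv_integral_sq_le h3 h4 h2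
  have h8 : 32 ≤ (r i)⁻¹ := by
    rw [le_inv_comm₀ (by norm_num) h3]; linarith
  rw [div_eq_mul_inv, abs_mul, abs_mul, abs_of_pos (by positivity : 0 < 2 * r i),
    abs_of_pos (inv_pos.2 hI)]
  calc 2 * r i * |v i - u₀ i| * (∫ y, f i y ^ 2)⁻¹
      ≤ 2 * r i * (r i ^ N)⁻¹ * (16 * (r i)⁻¹) := by gcongr
    _ = 32 * (r i ^ N)⁻¹ := by field_simp; norm_num
    _ ≤ (r i)⁻¹ * (r i ^ N)⁻¹ := by gcongr
    _ = _ := by rw [pow_succ, mul_inv]; ring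

theorem eventually_norm_integral_hopfExpr_lt (hr : Tendsto r l (nhdsWithin 0 (Set.Ioi 0)))
    (hf : ∀ m, ∀ᶠ i in l, f i ∈ barFiber (r i) m)
    (hd : ∃ n : ℕ, ∀ᶠ i in l, |v i - u₀ i| ≤ (r i ^ n)⁻¹)
    {τ : ℝ → ℂ} (hτ : ContDiff ℝ ∞ τ) (hs : HasCompactSupport τ) (t : ι → ℝ) (n : ℕ) :
    ∀ᶠ i in l, ‖∫ x, (hopfExpr (wave (r i) (f i) (u₀ i) (v i)) x (t i) : ℂ) * τ x‖ < r i ^ n := by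
  obtain ⟨N, hN⟩ := hd
  have hτ' : ContDiff ℝ ∞ (deriv τ) := (contDiff_infty_iff_deriv.1 hτ).2
  obtain ⟨M, hM⟩ := hs.deriv.exists_bound_of_continuous hτ'.continuous
  -- The prefactor costs `r ^ (-2N)` and the moments `r ^ (-2)`; the last power of `r` absorbs the
  -- constant `544 C = 2 · 16 · 17 · C`.
  obtain ⟨C, hC0, hC⟩ := exists_taylor_bound (n + 2 * N + 3) (deriv τ) hτ' hs.deriv
  filter_upwards [hN, hf 1, hf (n + 2 * N + 3), eventually_mul_lt_one hr (544 * C)]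
    with i h1 h2 h6 ⟨h3, h4, h5⟩
  obtain ⟨hI, hI'⟩ := inv_integral_sq_le h3 h4 h2
  obtain ⟨c, hc⟩ := hC (v i * t i)
  have hb := norm_integral_moment_le (x := v i * t i) hτ'.continuous h3 hM hc h6.1
  have hm := moments_le_of_mem_barFiber h3 h4 h6 le_rfl
  have hl := abs_log_le_inv h3 h4
  have hr1 : 1 ≤ (r i)⁻¹ := (one_le_inv₀ h3).2 h4.le
  have hsum : (∫ y, |f i y * y ^ (n + 2 * N + 3)|) +
      (∫ y, |f i y ^ 2 * y ^ (n + 2 * N + 3)|) / (∫ z, f i z ^ 2) ≤ 17 * ((r i)⁻¹ * (r i)⁻¹) := by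
    rw [div_eq_mul_inv]
    have e1 : ∫ y, |f i y * y ^ (n + 2 * N + 3)| ≤ (r i)⁻¹ * (r i)⁻¹ :=
      (hm.1.trans hl).trans (le_mul_of_one_le_left (by positivity) hr1)
    have e2 : (∫ y, |f i y ^ 2 * y ^ (n + 2 * N + 3)|) * (∫ z, f i z ^ 2)⁻¹ ≤
        (r i)⁻¹ * (16 * (r i)⁻¹) :=
      mul_le_mul (hm.2.trans hl) hI' (by positivity) (by positivity)
    linarith
  rw [integral_hopfExpr_mul h3 hI.ne' hτ hs, norm_mul, Complex.norm_real, Real.norm_eq_abs,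
    div_eq_mul_inv, abs_mul, abs_mul, abs_pow, abs_of_pos (by positivity : 0 < 2 * r i),
    abs_of_pos (inv_pos.2 hI)]
  calc _ ≤ 2 * r i * (r i ^ N)⁻¹ ^ 2 * (16 * (r i)⁻¹) *
        (C * r i ^ (n + 2 * N + 3) * (17 * ((r i)⁻¹ * (r i)⁻¹))) := by
        refine mul_le_mul (by gcongr) (hb.trans (by gcongr)) (norm_nonneg _) (by positivity)
    _ = 544 * C * r i * r i ^ n := by
        field_simp
        ring
    _ < 1 * r i ^ n := by gcongr
    _ = _ := one_mul _

/-- Decay of order `p (K + 1)` turns `|y| ≥ r ^ (-1/p)` into `|f y| ≤ |ln r| r ^ (K + 1)`, and the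
logarithm costs one power of `r`. -/
theorem eventually_abs_le_of_far (hr : Tendsto r l (nhdsWithin 0 (Set.Ioi 0)))
    (hf : ∀ m, ∀ᶠ i in l, f i ∈ decayFiber (r i) m) {y : ι → ℝ}
    (hy : ∃ p : ℕ, 0 < p ∧ ∀ᶠ i in l, (r i ^ (1 / (p : ℝ)))⁻¹ ≤ |y i|) (K : ℕ) :
    ∀ᶠ i in l, |f i (y i)| ≤ r i ^ K := by
  obtain ⟨p, hp, hy⟩ := hy
  filter_upwards [hy, hf (p * (K + 1)), eventually_mul_lt_one hr 1] with i h1 h2 ⟨h3, h4, _⟩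
  have h5 := (h2.2 _ le_rfl (y i)).trans (abs_log_le_inv h3 h4)
  rw [abs_mul, abs_pow] at h5
  have h6 : (r i ^ (K + 1))⁻¹ ≤ |y i| ^ (p * (K + 1)) := by
    calc (r i ^ (K + 1))⁻¹ = ((r i ^ (1 / (p : ℝ)))⁻¹) ^ (p * (K + 1)) := by
          rw [inv_pow, pow_mul, one_div, Real.rpow_inv_natCast_pow h3.le hp.ne']
      _ ≤ _ := by gcongr
  have h7 : |f i (y i)| * (r i ^ (K + 1))⁻¹ ≤ (r i)⁻¹ := by
    refine le_trans ?_ h5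
    gcongr
  rw [← div_eq_mul_inv, div_le_iff₀ (by positivity)] at h7
  refine h7.trans_eq ?_
  rw [pow_succ']
  field_simp

theorem eventually_conserves (hr : Tendsto r l (nhdsWithin 0 (Set.Ioi 0)))
    (hf : ∀ m, ∀ᶠ i in l, f i ∈ barFiber (r i) m)
    (hd : ∃ n : ℕ, ∀ᶠ i in l, |v i - u₀ i| ≤ (r i ^ n)⁻¹) {a b t : ι → ℝ}
    (ha : ∀ K : ℕ, ∀ᶠ i in l, |f i ((a i - v i * t i) / r i)| ≤ r i ^ K)
    (hb : ∀ K : ℕ, ∀ᶠ i in l, |f i ((b i - v i * t i) / r i)| ≤ r i ^ K) (n : ℕ) :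
    ∀ᶠ i in l, |massRate (wave (r i) (f i) (u₀ i) (v i)) (a i) (b i) (t i) -
        1 / 2 * (wave (r i) (f i) (u₀ i) (v i) (a i) (t i) ^ 2 -
          wave (r i) (f i) (u₀ i) (v i) (b i) (t i) ^ 2)| < r i ^ n := by
  obtain ⟨N, hN⟩ := hd
  filter_upwards [hN, hf 1, ha 0, hb 0, ha (n + 1 + (N + 1) + (N + 1)),
    hb (n + 1 + (N + 1) + (N + 1)), eventually_mul_lt_one hr (66 * 64)]
    with i h1 h2 ha0 hb0 hak hbk ⟨h3, h4, h5⟩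
  obtain ⟨hI, hI'⟩ := inv_integral_sq_le h3 h4 h2
  rw [massRate_wave h3.ne', wave_eq h3.ne', wave_eq h3.ne']
  set B := 2 * (v i - u₀ i) / (∫ y, f i y ^ 2) with hB
  set X := f i ((a i - v i * t i) / r i)
  set Y := f i ((b i - v i * t i) / r i)
  rw [pow_zero] at ha0 hb0
  have hP : (r i ^ N)⁻¹ ≤ (r i ^ (N + 1))⁻¹ :=
    inv_anti₀ (by positivity) (pow_le_pow_of_le_one h3.le h4.le (by omega))
  have hBle : |B| ≤ 32 * (r i ^ (N + 1))⁻¹ := by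
    rw [hB, div_eq_mul_inv, abs_mul, abs_mul, abs_two, abs_of_pos (inv_pos.2 hI)]
    calc 2 * |v i - u₀ i| * (∫ y, f i y ^ 2)⁻¹
        ≤ 2 * (r i ^ N)⁻¹ * (16 * (r i)⁻¹) := by gcongr
      _ = _ := by rw [pow_succ, mul_inv]; ring
  -- The defect contains the factor `X - Y`, which is smaller than any power of `r`; the other
  -- factors are moderate.
  have e : v i * (u₀ i + B * X - (u₀ i + B * Y)) -
      1 / 2 * ((u₀ i + B * X) ^ 2 - (u₀ i + B * Y) ^ 2) =
      B * (X - Y) * ((v i - u₀ i) - B * (X + Y) / 2) := by ring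
  have hXY : |X - Y| ≤ 2 * r i ^ (n + 1 + (N + 1) + (N + 1)) := (abs_sub _ _).trans (by linarith)
  have hXY' : |X + Y| ≤ 2 := (abs_add_le _ _).trans (by linarith)
  have h6 : |(v i - u₀ i) - B * (X + Y) / 2| ≤ 33 * (r i ^ (N + 1))⁻¹ := by
    have h7 : |B * (X + Y) / 2| ≤ 32 * (r i ^ (N + 1))⁻¹ := by
      rw [abs_div, abs_mul, abs_two, div_le_iff₀ two_pos]
      exact mul_le_mul hBle hXY' (abs_nonneg _) (by positivity)
    linarith [abs_sub (v i - u₀ i) (B * (X + Y) / 2)]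
  rw [e, abs_mul, abs_mul]
  calc |B| * |X - Y| * |(v i - u₀ i) - B * (X + Y) / 2|
      ≤ 32 * (r i ^ (N + 1))⁻¹ * (2 * r i ^ (n + 1 + (N + 1) + (N + 1))) *
        (33 * (r i ^ (N + 1))⁻¹) := by gcongr
    _ = 2112 * r i * r i ^ n := by
        field_simp
        ring
    _ < 1 * r i ^ n := by
        gcongr
        linarith
    _ = _ := one_mul _

end Asymptotics

/-! ### Transfer of the estimates to germs. -/

section Main

variable {ι : Type*} {U : Ultrafilter ι} {r : ι → ℝ} {f : ι → 𝓢(ℝ, ℝ)}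

theorem tendsto_of_isPosInfinitesimal (h : IsPosInfinitesimal (U := U) (r : Ext U ℝ)) :
    Tendsto r U (nhdsWithin 0 (Set.Ioi 0)) := by
  obtain ⟨h0, h1⟩ := isPosInfinitesimal_coe.1 h
  refine tendsto_nhdsWithin_iff.2 ⟨tendsto_order.2 ⟨fun a ha => ?_, fun a ha => ?_⟩, h0⟩
  · exact h0.mono fun i hi => ha.trans hi
  · obtain ⟨n, hn⟩ := exists_nat_one_div_lt ha
    exact (h1 n).mono fun i hi => hi.trans hn

theorem deltaWave_of_mem (hr : Tendsto r U (nhdsWithin 0 (Set.Ioi 0)))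
    (hf : ∀ m, ∀ᶠ i in U, f i ∈ barFiber (r i) m) {u₀ v : ι → ℝ}
    (hu : RhoModerate (U := U) (r : Ext U ℝ) (u₀ : Ext U ℝ))
    (hv : RhoModerate (U := U) (r : Ext U ℝ) (v : Ext U ℝ)) :
    RhoModerate (r : Ext U ℝ)
      (amplitude (r : Ext U ℝ) (f : Ext U 𝓢(ℝ, ℝ)) (u₀ : Ext U ℝ) (v : Ext U ℝ)) ∧
    WeakHopfSolution (r : Ext U ℝ) (starWave U r f u₀ v) := by
  have hd := exists_abs_sub_le hr (rhoModerate_coe.1 hu) (rhoModerate_coe.1 hv)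
  exact ⟨rhoModerate_amplitude_coe.2 (exists_amplitude_le hr hf hd),
    weakHopfSolution_starWave.2 fun τ t n =>
      eventually_norm_integral_hopfExpr_lt hr hf hd τ.contDiff τ.hasCompactSupport t n⟩

theorem integralOf_eq_one (hf : ∀ m, ∀ᶠ i in U, f i ∈ barFiber (r i) m) :
    integralOf (f : Ext U 𝓢(ℝ, ℝ)) = 1 :=
  Germ.coe_eq.2 ((hf 0).mono fun _ hi => integral_eq_one_of_mem_momentSet hi.1)

theorem conservesOn_of_onOrOffFront (hr : Tendsto r U (nhdsWithin 0 (Set.Ioi 0)))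
    (hf : ∀ m, ∀ᶠ i in U, f i ∈ decayFiber (r i) m) {u₀ v : ι → ℝ}
    (hu : RhoModerate (U := U) (r : Ext U ℝ) (u₀ : Ext U ℝ))
    (hv : RhoModerate (U := U) (r : Ext U ℝ) (v : Ext U ℝ)) {a b t : Ext U ℝ}
    (ha : OnOrOffFront (r : Ext U ℝ) (v : Ext U ℝ) a t)
    (hb : OnOrOffFront (r : Ext U ℝ) (v : Ext U ℝ) b t) :
    ConservesOn (r : Ext U ℝ) (starWave U r f u₀ v) a b t := by
  induction a using Germ.inductionOn with | _ a
  induction b using Germ.inductionOn with | _ b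
  induction t using Germ.inductionOn with | _ t
  have hd := exists_abs_sub_le hr (rhoModerate_coe.1 hu) (rhoModerate_coe.1 hv)
  have key {c : ι → ℝ} (hc : OnOrOffFront (r : Ext U ℝ) (v : Ext U ℝ) (c : Ext U ℝ) (t : Ext U ℝ))
      (K : ℕ) : ∀ᶠ i in U, |f i ((c i - v i * t i) / r i)| ≤ r i ^ K := by
    rcases onOrOffFront_coe.1 hc with h | h
    · filter_upwards [h, hf 0, eventually_mul_lt_one hr 1] with i h1 h2 ⟨h3, _⟩
      rw [h1, sub_self, zero_div, h2.1.2.1, abs_zero]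
      positivity
    · exact eventually_abs_le_of_far hr hf h K
  exact conservesOn_starWave.2 (eventually_conserves hr
    (fun m => (hf m).mono fun _ hi => hi.1) hd (key ha) (key hb))

/-- A standard point off the front lies at a fixed distance `δ > 0`, and `δ / r ≥ r ^ (-1/2)` once
`r ≤ δ²`. -/
theorem onOrOffFront_const (hr : Tendsto r U (nhdsWithin 0 (Set.Ioi 0))) (v a t : ℝ) :
    OnOrOffFront (r : Ext U ℝ) (v : Ext U ℝ) (a : Ext U ℝ) (t : Ext U ℝ) := by
  refine (onOrOffFront_coe (v := fun _ => v) (a := fun _ => a) (t := fun _ => t)).2 ?_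
  rcases eq_or_ne a (v * t) with h | h
  · exact Or.inl (.of_forall fun _ => h)
  · have hpos : 0 < |a - v * t| := abs_pos.2 (sub_ne_zero.2 h)
    refine Or.inr ⟨2, two_pos, ?_⟩
    filter_upwards [eventually_mul_lt_one hr ((|a - v * t| ^ 2)⁻¹)] with i ⟨h0, _, h1⟩
    rw [inv_mul_lt_iff₀ (by positivity), mul_one] at h1
    have h2 : √(r i) ≤ |a - v * t| := (Real.sqrt_le_left hpos.le).2 h1.le
    have h3 : 0 < √(r i) := Real.sqrt_pos.2 h0
    rw [abs_div, abs_of_pos h0, Nat.cast_two, ← Real.sqrt_eq_rpow, inv_eq_one_div,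
      div_le_div_iff₀ h3 h0]
    calc 1 * r i = √(r i) * √(r i) := by rw [one_mul, Real.mul_self_sqrt h0.le]
      _ ≤ _ := by gcongr

end Main

end NSHopf

end

theorem mainTheorem1 {d : ℕ} (hd : 0 < d) (U : Ultrafilter (NSHopf.TestFun d))
    (hU : NSHopf.ContainsBasicFilter U)
    (ρ : NSHopf.Ext U ℝ) (hρ : NSHopf.IsPosInfinitesimal ρ) :
    -- the sets `S̄_m` are internal and nested
    (∀ m, NSHopf.IsInternal (NSHopf.barMomentSet ρ m)) ∧
    Antitone (NSHopf.barMomentSet ρ) ∧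
    -- every member of their intersection gives weak solutions
    (∀ Θ ∈ ⋂ m, NSHopf.barMomentSet ρ m,
      NSHopf.integralOf Θ = 1 ∧ NSHopf.schwartzVal Θ 0 = 0 ∧
      ∀ u₀ v : NSHopf.Ext U ℝ, NSHopf.RhoModerate ρ u₀ → NSHopf.RhoModerate ρ v →
        NSHopf.RhoModerate ρ (NSHopf.amplitude ρ Θ u₀ v) ∧
        ∃ u : NSHopf.Ext U NSHopf.SmoothPlane,
          NSHopf.IsDeltaWave ρ Θ u₀ v (NSHopf.amplitude ρ Θ u₀ v) u ∧
          NSHopf.WeakHopfSolution ρ u) ∧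
    -- a single member gives weak solutions that also satisfy the conservation law
    (∃ Θ ∈ ⋂ m, NSHopf.barMomentSet ρ m,
      NSHopf.integralOf Θ = 1 ∧ NSHopf.schwartzVal Θ 0 = 0 ∧
      ∀ u₀ v : NSHopf.Ext U ℝ, NSHopf.RhoModerate ρ u₀ → NSHopf.RhoModerate ρ v →
        NSHopf.RhoModerate ρ (NSHopf.amplitude ρ Θ u₀ v) ∧
        ∃ u : NSHopf.Ext U NSHopf.SmoothPlane,
          NSHopf.IsDeltaWave ρ Θ u₀ v (NSHopf.amplitude ρ Θ u₀ v) u ∧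
          NSHopf.WeakHopfSolution ρ u ∧
          (∀ a b t : NSHopf.Ext U ℝ, 0 < t →
            NSHopf.OnOrOffFront ρ v a t → NSHopf.OnOrOffFront ρ v b t →
            NSHopf.ConservesOn ρ u a b t) ∧
          (∀ v₁ : ℝ, v = (v₁ : NSHopf.Ext U ℝ) → ∀ a b t : ℝ, 0 < t →
            NSHopf.ConservesOn ρ u (a : NSHopf.Ext U ℝ) (b : NSHopf.Ext U ℝ)
              (t : NSHopf.Ext U ℝ))) := by
  induction ρ using Filter.Germ.inductionOn with | _ r
  have hr := NSHopf.tendsto_of_isPosInfinitesimal hρ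
  refine ⟨NSHopf.isInternal_barMomentSet _, NSHopf.antitone_barMomentSet _, ?_, ?_⟩
  · intro Θ hΘ
    induction Θ using Filter.Germ.inductionOn with | _ f
    rw [Set.mem_iInter] at hΘ
    have hf := fun m => NSHopf.coe_mem_barMomentSet.1 (hΘ m)
    refine ⟨NSHopf.integralOf_eq_one hf, (hΘ 0).2.1, fun u₀ v hu hv => ?_⟩
    induction u₀ using Filter.Germ.inductionOn with | _ u₀
    induction v using Filter.Germ.inductionOn with | _ v
    obtain ⟨h1, h2⟩ := NSHopf.deltaWave_of_mem hr hf hu hv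
    exact ⟨h1, NSHopf.starWave U r f u₀ v, NSHopf.isDeltaWave_starWave, h2⟩
  · obtain ⟨f, hdec⟩ := NSHopf.exists_eventually_mem_decayFiber hr
    have hf := fun m => (hdec m).mono fun _ hi => hi.1
    have hΘ := fun m => NSHopf.coe_mem_barMomentSet.2 (hf m)
    refine ⟨(Filter.Germ.ofFun f), Set.mem_iInter.2 hΘ, NSHopf.integralOf_eq_one hf, (hΘ 0).2.1,
      fun u₀ v hu hv => ?_⟩
    induction u₀ using Filter.Germ.inductionOn with | _ u₀
    induction v using Filter.Germ.inductionOn with | _ v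
    obtain ⟨h1, h2⟩ := NSHopf.deltaWave_of_mem hr hf hu hv
    refine ⟨h1, NSHopf.starWave U r f u₀ v, NSHopf.isDeltaWave_starWave, h2,
      fun a b t _ ha hb => NSHopf.conservesOn_of_onOrOffFront hr hdec hu hv ha hb,
      fun v₁ hv₁ a b t _ => NSHopf.conservesOn_of_onOrOffFront hr hdec hu hv ?_ ?_⟩ <;>
    · rw [hv₁]
      exact NSHopf.onOrOffFront_const hr _ _ _
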